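/- All vector lattices are real and Archimedean. A lattice-normed space (LNS) $(X,p,E)$ consists of a real vector space $X$, a vector lattice $E$ and a map $p:X\to E_+$ with $p(x)=0\Leftrightarrow x=0$, $p(\lambda x)=|\lambda|p(x)$ and $p(x+y)\le p(x)+p(y)$. It is decomposable if $p(x)=e_1+e_2$ with $e_1,e_2\in E_+$ implies $x=x_1+x_2$ for some $x_1,x_2\in X$ with $p(x_1)=e_1$ and $p(x_2)=e_2$. A net $(x_\alpha)$ in a vector lattice order converges to $x$ if there is a net $y_\beta\downarrow 0$ (possibly over another index set) such that for every $\beta$ there is $\alpha_\beta$ with $|x_\alpha-x|\le y_\beta$ for all $\alpha\ge\alpha_\beta$. A net $(x_\alpha)$ in an LNS $(X,p,E)$ $p$-converges to $x$ if $p(x_\alpha-x)$ order converges to $0$ in $E$. A sequence $(x_n)$ is $p$-Cauchy if the net $(x_m-x_n)_{(m,n)\in\mathbb N\times\mathbb N}$ $p$-converges to $0$, and the LNS is sequentially $p$-complete if every $p$-Cauchy sequence $p$-converges to some element of $X$. A set $A\subseteq X$ is $p$-bounded if there is $e\in E$ with $p(a)\le e$ for all $a\in A$. Let $(X,p,E)$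 and $(Y,q,F)$ be LNSs. A linear operator $T:X\to Y$ is sequentially $p$-compact if for every $p$-bounded sequence $(x_n)$ in $X$ there are a subsequence $(x_{n_k})$ and $y\in Y$ such that $Tx_{n_k}$ $p$-converges to $y$. It is dominated if there is a positive linear operator $S:E\to F$ (a dominant of $T$) with $q(Tx)\le S(p(x))$ for all $x\in X$; $M(X,Y)$ is the vector space of dominated operators. Let $L^\sim(E,F)$ be the space of order bounded linear operators, ordered by $S\le R$ iff $Se\le Re$ for all $e\in E_+$. If $X$ is decomposable and $F$ is order complete, then every $T\in M(X,Y)$ has a least dominant $\pmb{|}T\pmb{|}$ in $L^\sim(E,F)$, called its exact dominant, and $T\mapsto\pmb{|}T\pmb{|}$ makes $M(X,Y)$ an LNS over $L^\sim(E,F)$. **Theorem.** Let $(X,p,E)$ be a decomposable LNS and let $(Y,q,F)$ be a sequentially $p$-complete LNS such that $F$ is order complete. Let $(T_m)_{m\in\mathbb N}$ be a sequence in $M(X,Y)$ such that each $T_m$ is sequentially $p$-compact, and let $T\in M(X,Y)$ be such that $T_m$ $p$-converges to $T$ in $M(X,Y)$, i.e. $\pmb{|}T_m-T\pmb{|}$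 order converges to $0$ in $L^\sim(E,F)$. Then $T$ is sequentially $p$-compact. -/

import Mathlib

/-! Lattice-normed spaces.  A vector lattice is a real vector space with a lattice order compatible
with the linear structure. -/

/-- The Archimedean property of an ordered vector space: if `n x ≤ y` for all `n`, then `x ≤ 0`. -/
def ArchimedeanSpace (E : Type*) [AddCommGroup E] [PartialOrder E] : Prop :=
  ∀ x y : E, (∀ n : ℕ, n • x ≤ y) → x ≤ 0

/-- Order convergence of a net `x` to `a`: some family `D` decreasing to `0` (a nonempty, downward
directed set with infimum `0`, i.e. the set of values of a decreasing net with infimum `0`; it need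
not be indexed by `A`) is such that each `d ∈ D` eventually dominates `|x i - a|`.  The inequality
`|x i - a| ≤ d` is written `-d ≤ x i - a ≤ d`, so that it makes sense in any ordered vector
space. -/
def OrderConverges {A E : Type*} [Preorder A] [AddCommGroup E] [PartialOrder E]
    (x : A → E) (a : E) : Prop :=
  ∃ D : Set E, D.Nonempty ∧ DirectedOn (· ≥ ·) D ∧ IsGLB D 0 ∧
    ∀ d ∈ D, ∃ i₀ : A, ∀ i, i₀ ≤ i → -d ≤ x i - a ∧ x i - a ≤ d

/-- In a vector lattice the two-sided inequality is the one with the absolute value. -/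
theorem orderConverges_iff_abs {A E : Type*} [Preorder A] [AddCommGroup E] [Lattice E]
    [IsOrderedAddMonoid E] (x : A → E) (a : E) :
    OrderConverges x a ↔ ∃ D : Set E, D.Nonempty ∧ DirectedOn (· ≥ ·) D ∧ IsGLB D 0 ∧
      ∀ d ∈ D, ∃ i₀ : A, ∀ i, i₀ ≤ i → |x i - a| ≤ d := by
  have h : ∀ u v : E, |u| ≤ v ↔ -v ≤ u ∧ u ≤ v := fun u v => by rw [abs_le', neg_le, and_comm]
  simp only [OrderConverges, h]

/-- A vector norm on `X` with values in the positive cone of `E`.  When `E` is a vector lattice,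
`(X, p, E)` is a lattice-normed space. -/
structure VectorNorm (X E : Type*) [AddCommGroup X] [Module ℝ X]
    [AddCommGroup E] [PartialOrder E] [Module ℝ E] where
  toFun : X → E
  nonneg' : ∀ x, 0 ≤ toFun x
  eq_zero_iff' : ∀ x, toFun x = 0 ↔ x = 0
  smul' : ∀ (c : ℝ) (x : X), toFun (c • x) = |c| • toFun x
  add_le' : ∀ x y, toFun (x + y) ≤ toFun x + toFun y

namespace VectorNorm

section
variable {X E : Type*} [AddCommGroup X] [Module ℝ X] [AddCommGroup E] [PartialOrder E] [Module ℝ E]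

instance : CoeFun (VectorNorm X E) (fun _ => X → E) := ⟨VectorNorm.toFun⟩

/-- Decomposability of a vector norm. -/
def Decomposable (p : VectorNorm X E) : Prop :=
  ∀ (x : X) (e₁ e₂ : E), 0 ≤ e₁ → 0 ≤ e₂ → p x = e₁ + e₂ →
    ∃ x₁ x₂ : X, x = x₁ + x₂ ∧ p x₁ = e₁ ∧ p x₂ = e₂

/-- `p`-convergence of a net. -/
def Converges {A : Type*} [Preorder A] (p : VectorNorm X E) (x : A → X) (a : X) : Prop :=
  OrderConverges (fun i => p (x i - a)) 0

/-- A sequence is `p`-Cauchy if the net `x m - x n`, indexed by `ℕ × ℕ`, `p`-converges to `0`. -/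
def IsCauchySeq (p : VectorNorm X E) (x : ℕ → X) : Prop :=
  p.Converges (fun i : ℕ × ℕ => x i.1 - x i.2) 0

/-- Sequential `p`-completeness. -/
def SeqComplete (p : VectorNorm X E) : Prop :=
  ∀ x : ℕ → X, p.IsCauchySeq x → ∃ a, p.Converges x a

/-- `p`-boundedness of a set. -/
def Bounded (p : VectorNorm X E) (A : Set X) : Prop :=
  ∃ e : E, ∀ a ∈ A, p a ≤ e

end

end VectorNorm

section
variable {X Y E F : Type*} [AddCommGroup X] [Module ℝ X] [AddCommGroup Y] [Module ℝ Y]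
  [AddCommGroup E] [PartialOrder E] [Module ℝ E] [AddCommGroup F] [PartialOrder F] [Module ℝ F]

/-- Sequential `p`-compactness of a linear operator. -/
def SeqPCompact (p : VectorNorm X E) (q : VectorNorm Y F) (T : X →ₗ[ℝ] Y) : Prop :=
  ∀ x : ℕ → X, p.Bounded (Set.range x) →
    ∃ φ : ℕ → ℕ, StrictMono φ ∧ ∃ y : Y, q.Converges (fun k => T (x (φ k))) y

/-- `S` is a dominant of `T`: a positive operator with `q (T x) ≤ S (p x)` for all `x`. -/
def IsDominant (p : VectorNorm X E) (q : VectorNorm Y F) (T : X →ₗ[ℝ] Y) (S : E →ₗ[ℝ] F) : Prop :=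
  (∀ e, 0 ≤ e → 0 ≤ S e) ∧ ∀ x, q (T x) ≤ S (p x)

end

set_option linter.unusedSectionVars false

section OrderBounded
variable (E F : Type*) [AddCommGroup E] [Lattice E] [IsOrderedAddMonoid E] [Module ℝ E]
  [AddCommGroup F] [Lattice F] [IsOrderedAddMonoid F] [Module ℝ F] [IsOrderedModule ℝ F]

/-- The linear operators that map order bounded sets (equivalently, order intervals) to order
bounded sets. -/
def orderBoundedSubmodule : Submodule ℝ (E →ₗ[ℝ] F) where
  carrier := {S | ∀ a b : E, ∃ c d : F, ∀ e ∈ Set.Icc a b, S e ∈ Set.Icc c d}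
  zero_mem' := fun _ _ => ⟨0, 0, fun _ _ => by simp⟩
  add_mem' := by
    intro S R hS hR a b
    obtain ⟨c, d, h⟩ := hS a b
    obtain ⟨c', d', h'⟩ := hR a b
    exact ⟨c + c', d + d', fun e he => ⟨add_le_add (h e he).1 (h' e he).1,
      add_le_add (h e he).2 (h' e he).2⟩⟩
  smul_mem' := by
    intro r S hS a b
    obtain ⟨c, d, h⟩ := hS a b
    rcases le_total 0 r with hr | hr
    · exact ⟨r • c, r • d, fun e he => ⟨smul_le_smul_of_nonneg_left (h e he).1 hr,
        smul_le_smul_of_nonneg_left (h e he).2 hr⟩⟩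
    · refine ⟨r • d, r • c, fun e he => ?_⟩
      have h1 := smul_le_smul_of_nonneg_left (h e he).1 (neg_nonneg.2 hr)
      have h2 := smul_le_smul_of_nonneg_left (h e he).2 (neg_nonneg.2 hr)
      simp only [neg_smul, neg_le_neg_iff] at h1 h2
      exact ⟨h2, h1⟩

/-- The space `L^~(E, F)` of order bounded operators, ordered by
`S ≤ R ↔ S e ≤ R e` for all `e ≥ 0`. -/
def OrderBoundedOp : Type _ := orderBoundedSubmodule E F

noncomputable instance : AddCommGroup (OrderBoundedOp E F) :=
  inferInstanceAs (AddCommGroup (orderBoundedSubmodule E F))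

noncomputable instance : Module ℝ (OrderBoundedOp E F) :=
  inferInstanceAs (Module ℝ (orderBoundedSubmodule E F))

variable {E F}

/-- The underlying linear operator. -/
def OrderBoundedOp.toLin (S : OrderBoundedOp E F) : E →ₗ[ℝ] F := S.1

theorem OrderBoundedOp.ext_cone {S R : OrderBoundedOp E F}
    (h : ∀ e : E, 0 ≤ e → S.toLin e = R.toLin e) : S = R := by
  apply Subtype.ext
  apply LinearMap.ext
  intro e
  have h1 := h e⁺ (posPart_nonneg e)
  have h2 := h e⁻ (negPart_nonneg e)
  have : S.toLin (e⁺ - e⁻) = R.toLin (e⁺ - e⁻) := by rw [map_sub, map_sub, h1, h2]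
  rwa [posPart_sub_negPart] at this

instance : PartialOrder (OrderBoundedOp E F) where
  le S R := ∀ e : E, 0 ≤ e → S.toLin e ≤ R.toLin e
  le_refl _ _ _ := le_rfl
  le_trans _ _ _ h h' e he := (h e he).trans (h' e he)
  le_antisymm _ _ h h' := OrderBoundedOp.ext_cone fun e he => le_antisymm (h e he) (h' e he)

theorem OrderBoundedOp.le_def (S R : OrderBoundedOp E F) :
    S ≤ R ↔ ∀ e : E, 0 ≤ e → S.toLin e ≤ R.toLin e := Iff.rfl

@[simp] theorem OrderBoundedOp.toLin_zero : (0 : OrderBoundedOp E F).toLin = 0 := rfl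
@[simp] theorem OrderBoundedOp.toLin_add (S R : OrderBoundedOp E F) :
    (S + R).toLin = S.toLin + R.toLin := rfl
@[simp] theorem OrderBoundedOp.toLin_smul (c : ℝ) (S : OrderBoundedOp E F) :
    (c • S).toLin = c • S.toLin := rfl

/-- Positive operators are order bounded. -/
def OrderBoundedOp.ofPositive (S : E →ₗ[ℝ] F) (hS : ∀ e, 0 ≤ e → 0 ≤ S e) : OrderBoundedOp E F :=
  ⟨S, fun a b => ⟨S a, S b, fun e he => by
    have h1 := hS _ (sub_nonneg.2 he.1)
    have h2 := hS _ (sub_nonneg.2 he.2)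
    rw [map_sub, sub_nonneg] at h1 h2
    exact ⟨h1, h2⟩⟩⟩

@[simp] theorem OrderBoundedOp.toLin_ofPositive (S : E →ₗ[ℝ] F) (hS : ∀ e, 0 ≤ e → 0 ≤ S e) :
    (OrderBoundedOp.ofPositive S hS).toLin = S := rfl

end OrderBounded

section Dominated
variable {X Y E F : Type*} [AddCommGroup X] [Module ℝ X] [AddCommGroup Y] [Module ℝ Y]
  [AddCommGroup E] [Lattice E] [IsOrderedAddMonoid E] [Module ℝ E]

/-- An additive, positively homogeneous map on the positive cone extends to a linear map. -/
theorem exists_linear_extension [AddCommGroup F] [Module ℝ F] [IsOrderedModule ℝ E] (f : E → F)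
    (hadd : ∀ a b, 0 ≤ a → 0 ≤ b → f (a + b) = f a + f b)
    (hsmul : ∀ (c : ℝ) a, 0 ≤ c → 0 ≤ a → f (c • a) = c • f a) :
    ∃ S : E →ₗ[ℝ] F, ∀ e, 0 ≤ e → S e = f e := by
  have key : ∀ a b : E, 0 ≤ a → 0 ≤ b → f (a - b)⁺ - f (a - b)⁻ = f a - f b := by
    intro a b ha hb
    have h : (a - b)⁺ + b = a + (a - b)⁻ := by
      have := posPart_sub_negPart (a - b)
      rw [sub_eq_iff_eq_add] at this
      rw [this]; abel
    have h2 := congrArg f h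
    rw [hadd _ _ (posPart_nonneg _) hb, hadd _ _ ha (negPart_nonneg _)] at h2
    rw [sub_eq_sub_iff_add_eq_add, h2]
  have f0 : f 0 = 0 := by simpa using hsmul 0 0 le_rfl le_rfl
  have hneg : ∀ e : E, f (-e)⁺ - f (-e)⁻ = -(f e⁺ - f e⁻) := by
    intro e; rw [posPart_neg, negPart_neg]; abel
  have hpos : ∀ (c : ℝ) (e : E), 0 ≤ c → f (c • e)⁺ - f (c • e)⁻ = c • (f e⁺ - f e⁻) := by
    intro c e hc
    have h := key (c • e⁺) (c • e⁻) (smul_nonneg hc (posPart_nonneg e))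
      (smul_nonneg hc (negPart_nonneg e))
    rw [← smul_sub, posPart_sub_negPart, hsmul _ _ hc (posPart_nonneg e),
      hsmul _ _ hc (negPart_nonneg e), ← smul_sub] at h
    exact h
  refine ⟨{ toFun := fun e => f e⁺ - f e⁻, map_add' := ?_, map_smul' := ?_ }, ?_⟩
  · intro e e'
    have h := key (e⁺ + e'⁺) (e⁻ + e'⁻) (add_nonneg (posPart_nonneg _) (posPart_nonneg _))
      (add_nonneg (negPart_nonneg _) (negPart_nonneg _))
    rw [add_sub_add_comm, posPart_sub_negPart, posPart_sub_negPart,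
      hadd _ _ (posPart_nonneg _) (posPart_nonneg _),
      hadd _ _ (negPart_nonneg _) (negPart_nonneg _)] at h
    rw [h]; abel
  · intro c e
    rcases le_total 0 c with hc | hc
    · exact hpos c e hc
    · have h := hpos (-c) (-e) (neg_nonneg.2 hc)
      rw [neg_smul_neg, hneg, neg_smul_neg] at h
      exact h
  · intro e he
    change f e⁺ - f e⁻ = f e
    rw [posPart_eq_self.2 he, negPart_eq_zero.2 he, f0, sub_zero]

variable [AddCommGroup F]

/-- The space `M(X, Y)` of dominated operators. -/
def dominatedOperators [Lattice F] [IsOrderedAddMonoid F] [Module ℝ F] [IsOrderedModule ℝ F]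
    (p : VectorNorm X E) (q : VectorNorm Y F) :
    Submodule ℝ (X →ₗ[ℝ] Y) where
  carrier := {T | ∃ S : E →ₗ[ℝ] F, IsDominant p q T S}
  zero_mem' := ⟨0, fun _ _ => le_rfl, fun x => by
    simp [(q.eq_zero_iff' 0).2 rfl]⟩
  add_mem' := by
    rintro T T' ⟨S, hS, h⟩ ⟨S', hS', h'⟩
    exact ⟨S + S', fun e he => add_nonneg (hS e he) (hS' e he),
      fun x => (q.add_le' _ _).trans (add_le_add (h x) (h' x))⟩
  smul_mem' := by
    rintro c T ⟨S, hS, h⟩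
    refine ⟨|c| • S, fun e he => smul_nonneg (abs_nonneg c) (hS e he), fun x => ?_⟩
    simp only [LinearMap.smul_apply, q.smul']
    exact smul_le_smul_of_nonneg_left (h x) (abs_nonneg c)

/-- `S` is the exact dominant of `T`: the least element of the set of all dominants of `T` in
`L^~(E, F)`. -/
def IsExactDominant [Lattice F] [IsOrderedAddMonoid F] [Module ℝ F] [IsOrderedModule ℝ F]
    (p : VectorNorm X E) (q : VectorNorm Y F) (T : X →ₗ[ℝ] Y) (S : OrderBoundedOp E F) : Prop :=
  IsLeast {S : OrderBoundedOp E F | IsDominant p q T S.toLin} S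

/-- Riesz decomposition along a finite family, for a decomposable norm. -/
theorem exists_list_decomposition [PartialOrder F] [IsOrderedAddMonoid F] [Module ℝ F]
    (p : VectorNorm X E) (q : VectorNorm Y F) (hp : p.Decomposable) (T : X →ₗ[ℝ] Y) (l : List X) :
    ∀ a b : E, 0 ≤ a → 0 ≤ b → (l.map fun x => p x).sum ≤ a + b →
      ∃ l₁ l₂ : List X, (l₁.map fun x => p x).sum ≤ a ∧ (l₂.map fun x => p x).sum ≤ b ∧
        (l.map fun x => q (T x)).sum ≤
          (l₁.map fun x => q (T x)).sum + (l₂.map fun x => q (T x)).sum := by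
  induction l with
  | nil => intro a b ha hb _; exact ⟨[], [], by simpa using ha, by simpa using hb, by simp⟩
  | cons x l ih =>
    intro a b ha hb h
    simp only [List.map_cons, List.sum_cons] at h
    have hs : 0 ≤ (l.map fun x => p x).sum := by
      apply List.sum_nonneg
      intro e he
      obtain ⟨z, _, rfl⟩ := List.mem_map.1 he
      exact p.nonneg' z
    have hx : p x ≤ a + b := (le_add_of_nonneg_right hs).trans h
    have h1 : 0 ≤ p x ⊓ a := le_inf (p.nonneg' x) ha
    have h2 : 0 ≤ p x - p x ⊓ a := sub_nonneg.2 inf_le_left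
    have h3 : p x - p x ⊓ a ≤ b := by
      rw [sub_le_comm]
      exact le_inf (sub_le_self _ hb) (sub_le_iff_le_add.2 hx)
    obtain ⟨u, v, huv, hu, hv⟩ := hp x _ _ h1 h2 (by abel)
    obtain ⟨l₁, l₂, g1, g2, g3⟩ := ih (a - p x ⊓ a) (b - (p x - p x ⊓ a))
      (sub_nonneg.2 inf_le_right) (sub_nonneg.2 h3) (by
        have : a - p x ⊓ a + (b - (p x - p x ⊓ a)) = a + b - p x := by abel
        rw [this]; exact le_sub_iff_add_le'.2 h)
    refine ⟨u :: l₁, v :: l₂, ?_, ?_, ?_⟩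
    · simp only [List.map_cons, List.sum_cons, hu]
      exact le_sub_iff_add_le'.1 g1
    · simp only [List.map_cons, List.sum_cons, hv]
      exact le_sub_iff_add_le'.1 g2
    · simp only [List.map_cons, List.sum_cons]
      have h4 : q (T x) ≤ q (T u) + q (T v) := by rw [huv, map_add]; exact q.add_le' _ _
      calc _ ≤ (q (T u) + q (T v)) + _ := add_le_add h4 g3
        _ = _ := by abel

/-- For a decomposable `X` and an order complete `F`, every dominated operator has an exact
dominant. -/
theorem exists_isExactDominant [IsOrderedModule ℝ E] [ConditionallyCompleteLattice F]
    [IsOrderedAddMonoid F] [Module ℝ F] [IsOrderedModule ℝ F]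
    (p : VectorNorm X E) (q : VectorNorm Y F) (hp : p.Decomposable) (T : X →ₗ[ℝ] Y)
    (hT : T ∈ dominatedOperators p q) : ∃ S : OrderBoundedOp E F, IsExactDominant p q T S := by
  let P : List X → E := fun l => (l.map fun x => p x).sum
  let Q : List X → F := fun l => (l.map fun x => q (T x)).sum
  let A : E → Set F := fun e => {y | ∃ l : List X, P l ≤ e ∧ y = Q l}
  let f : E → F := fun e => sSup (A e)
  have hQP : ∀ S : E →ₗ[ℝ] F, IsDominant p q T S → ∀ l, Q l ≤ S (P l) := by
    intro S hS l
    induction l with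
    | nil => simp [Q, P]
    | cons x l ih =>
      have := add_le_add (hS.2 x) ih
      simpa [Q, P] using this
  have hub : ∀ S : E →ₗ[ℝ] F, IsDominant p q T S → ∀ e, S e ∈ upperBounds (A e) := by
    rintro S hS e _ ⟨l, hl, rfl⟩
    refine (hQP S hS l).trans ?_
    have := hS.1 _ (sub_nonneg.2 hl)
    rwa [map_sub, sub_nonneg] at this
  obtain ⟨S₀, hS₀⟩ := hT
  have hbdd : ∀ e, BddAbove (A e) := fun e => ⟨_, hub S₀ hS₀ e⟩
  have hzero : ∀ e, 0 ≤ e → (0 : F) ∈ A e := fun e he => ⟨[], by simpa [P] using he, by simp [Q]⟩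
  have hne : ∀ e, 0 ≤ e → (A e).Nonempty := fun e he => ⟨0, hzero e he⟩
  have hmem : ∀ e y, y ∈ A e → y ≤ f e := fun e y hy => le_csSup (hbdd e) hy
  have hadd : ∀ a b, 0 ≤ a → 0 ≤ b → f (a + b) = f a + f b := by
    intro a b ha hb
    apply le_antisymm
    · apply csSup_le (hne _ (add_nonneg ha hb))
      rintro _ ⟨l, hl, rfl⟩
      obtain ⟨l₁, l₂, h1, h2, h3⟩ := exists_list_decomposition p q hp T l a b ha hb hl
      exact h3.trans (add_le_add (hmem a _ ⟨l₁, h1, rfl⟩) (hmem b _ ⟨l₂, h2, rfl⟩))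
    · rw [← le_sub_iff_add_le]
      apply csSup_le (hne a ha)
      rintro _ ⟨l₁, h1, rfl⟩
      rw [le_sub_comm]
      apply csSup_le (hne b hb)
      rintro _ ⟨l₂, h2, rfl⟩
      rw [le_sub_iff_add_le']
      refine hmem _ _ ⟨l₁ ++ l₂, ?_, ?_⟩
      · simpa [P] using add_le_add h1 h2
      · simp [Q]
  have hPs : ∀ (c : ℝ) l, 0 ≤ c → P (l.map fun x => c • x) = c • P l := by
    intro c l hc
    induction l with
    | nil => simp [P]
    | cons x l ih =>
      simp only [P, List.map_cons, List.sum_cons] at ih ⊢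
      rw [ih, p.smul', abs_of_nonneg hc, smul_add]
  have hQs : ∀ (c : ℝ) l, 0 ≤ c → Q (l.map fun x => c • x) = c • Q l := by
    intro c l hc
    induction l with
    | nil => simp [Q]
    | cons x l ih =>
      simp only [Q, List.map_cons, List.sum_cons] at ih ⊢
      rw [ih, map_smul, q.smul', abs_of_nonneg hc, smul_add]
  have hsle : ∀ (c : ℝ) a, 0 ≤ c → 0 ≤ a → c • f a ≤ f (c • a) := by
    intro c a hc ha
    rcases hc.eq_or_lt with rfl | hc'
    · rw [zero_smul, zero_smul]; exact hmem _ _ (hzero 0 le_rfl)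
    · have : f a ≤ c⁻¹ • f (c • a) := by
        apply csSup_le (hne a ha)
        rintro _ ⟨l, hl, rfl⟩
        have h1 : c • Q l ≤ f (c • a) := hmem _ _ ⟨l.map fun x => c • x, by
          rw [hPs c l hc]; exact smul_le_smul_of_nonneg_left hl hc, (hQs c l hc).symm⟩
        have h2 := smul_le_smul_of_nonneg_left h1 (inv_nonneg.2 hc)
        rwa [inv_smul_smul₀ hc'.ne'] at h2
      have h2 := smul_le_smul_of_nonneg_left this hc
      rwa [smul_inv_smul₀ hc'.ne'] at h2
  have f0 : f 0 = 0 := by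
    have := hadd 0 0 le_rfl le_rfl
    simpa using this
  have hsmul : ∀ (c : ℝ) a, 0 ≤ c → 0 ≤ a → f (c • a) = c • f a := by
    intro c a hc ha
    refine le_antisymm ?_ (hsle c a hc ha)
    rcases hc.eq_or_lt with rfl | hc'
    · rw [zero_smul, zero_smul, f0]
    · have h := hsle c⁻¹ (c • a) (inv_nonneg.2 hc) (smul_nonneg hc ha)
      rw [inv_smul_smul₀ hc'.ne'] at h
      have h2 := smul_le_smul_of_nonneg_left h hc
      rwa [smul_inv_smul₀ hc'.ne'] at h2
  obtain ⟨S, hS⟩ := exists_linear_extension f hadd hsmul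
  have hSpos : ∀ e, 0 ≤ e → 0 ≤ S e := by
    intro e he; rw [hS e he]; exact hmem _ _ (hzero e he)
  refine ⟨OrderBoundedOp.ofPositive S hSpos, ⟨hSpos, fun x => ?_⟩, fun R hR e he => ?_⟩
  · change q (T x) ≤ S (p x)
    rw [hS _ (p.nonneg' x)]
    exact hmem _ _ ⟨[x], by simp [P], by simp [Q]⟩
  · change S e ≤ R.toLin e
    rw [hS e he]
    exact csSup_le (hne e he) (hub R.toLin hR e)

variable [IsOrderedModule ℝ E] [ConditionallyCompleteLattice F]
  [IsOrderedAddMonoid F] [Module ℝ F] [IsOrderedModule ℝ F]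

/-- The exact dominant of a dominated operator (for `X` decomposable and `F` order complete). -/
noncomputable def exactDominant (p : VectorNorm X E) (q : VectorNorm Y F) (hp : p.Decomposable)
    (T : dominatedOperators p q) : OrderBoundedOp E F :=
  (exists_isExactDominant p q hp T.1 T.2).choose

theorem exactDominant_spec (p : VectorNorm X E) (q : VectorNorm Y F) (hp : p.Decomposable)
    (T : dominatedOperators p q) : IsExactDominant p q T.1 (exactDominant p q hp T) :=
  (exists_isExactDominant p q hp T.1 T.2).choose_spec

/-- The lattice norm of `M(X, Y)`, with values in `L^~(E, F)`: it sends an operator to its exact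
dominant. -/
noncomputable def dominantNorm (p : VectorNorm X E) (q : VectorNorm Y F) (hp : p.Decomposable) :
    VectorNorm (dominatedOperators p q) (OrderBoundedOp E F) where
  toFun T := exactDominant p q hp T
  nonneg' T := (exactDominant_spec p q hp T).1.1
  eq_zero_iff' T := by
    constructor
    · intro h
      have h1 := (exactDominant_spec p q hp T).1.2
      rw [h] at h1
      apply Subtype.ext
      apply LinearMap.ext
      intro x
      exact (q.eq_zero_iff' _).1 (le_antisymm (h1 x) (q.nonneg' _))
    · rintro rfl
      refine le_antisymm ((exactDominant_spec p q hp 0).2 ⟨fun _ _ => le_rfl, fun x => ?_⟩)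
        (exactDominant_spec p q hp 0).1.1
      exact ((q.eq_zero_iff' _).2 rfl).le
  smul' c T := by
    have hle : ∀ (c : ℝ) (T : dominatedOperators p q),
        exactDominant p q hp (c • T) ≤ |c| • exactDominant p q hp T := by
      intro c T
      obtain ⟨h1, h2⟩ := (exactDominant_spec p q hp T).1
      refine (exactDominant_spec p q hp (c • T)).2
        ⟨fun e he => smul_nonneg (abs_nonneg c) (h1 e he), fun x => ?_⟩
      change q (c • T.1 x) ≤ |c| • _
      rw [q.smul']
      exact smul_le_smul_of_nonneg_left (h2 x) (abs_nonneg c)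
    refine le_antisymm (hle c T) ?_
    by_cases hc : c = 0
    · subst hc
      rw [abs_zero, zero_smul]
      exact (exactDominant_spec p q hp _).1.1
    · intro e he
      have h := hle c⁻¹ (c • T) e he
      rw [inv_smul_smul₀ hc, abs_inv] at h
      have h2 := smul_le_smul_of_nonneg_left h (abs_nonneg c)
      change |c| • (exactDominant p q hp T).toLin e ≤
        |c| • (|c|⁻¹ • (exactDominant p q hp (c • T)).toLin e) at h2
      rwa [smul_inv_smul₀ (abs_ne_zero.2 hc)] at h2
  add_le' T T' := by
    obtain ⟨h1, h2⟩ := (exactDominant_spec p q hp T).1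
    obtain ⟨h1', h2'⟩ := (exactDominant_spec p q hp T').1
    exact (exactDominant_spec p q hp (T + T')).2
      ⟨fun e he => add_nonneg (h1 e he) (h1' e he),
        fun x => (q.add_le' _ _).trans (add_le_add (h2 x) (h2' x))⟩

end Dominated

/-! The classical proof that norm limits of compact operators are compact carries over. For a
`p`-bounded sequence, a diagonal subsequence `x (δ k)` makes every `T m (x (δ k))` converge, say to
`y m`. Infima of directed sets of operators are computed pointwise on the positive cone
(`OrderBoundedOp.isGLB_eval`), so `T m` tends to `T₀` uniformly on `{x | p x ≤ e}`. The triangle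
inequality through `T m x`, `T₀ x` and `T n x` then shows that `y` is `p`-Cauchy; let `z` be its
limit.

Finally `q (T₀ (x (δ k)) - z) ≤ d + c + b` for large `k`, where `c` ranges over a set that depends
on `m`, hence on `d` and `b`. No single dominating net is at hand. Instead these eventual bounds
have no positive lower bound, and order completeness of `F` turns this into order convergence by
means of tail suprema (`VectorNorm.converges_of_eventual_bounds`). -/

/-- Diagonal extraction: if every subsequence has, for each `m`, a further subsequence with property
`P m`, then some subsequence is, for each `m`, eventually a subsequence of one with property
`P m`. -/
theorem exists_strictMono_diagonal {P : ℕ → (ℕ → ℕ) → Prop}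
    (h : ∀ m φ, StrictMono φ → ∃ ψ : ℕ → ℕ, StrictMono ψ ∧ P m (φ ∘ ψ)) :
    ∃ δ : ℕ → ℕ, StrictMono δ ∧ ∀ m, ∃ φ, P m φ ∧ ∀ k, m ≤ k → ∃ j, k ≤ j ∧ δ k = φ j := by
  choose! ψ hψ hP using h
  let Φ : ℕ → ℕ → ℕ := fun m => Nat.rec (ψ 0 id) (fun m φ => φ ∘ ψ (m + 1) φ) m
  have hsucc : ∀ m, Φ (m + 1) = Φ m ∘ ψ (m + 1) (Φ m) := fun _ => rfl
  have hΦ : ∀ m, StrictMono (Φ m) := by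
    intro m
    induction m with
    | zero => exact hψ 0 id strictMono_id
    | succ m ih => rw [hsucc]; exact ih.comp (hψ _ _ ih)
  have hPΦ : ∀ m, P m (Φ m) := by
    intro m
    cases m with
    | zero => exact hP 0 id strictMono_id
    | succ m => rw [hsucc]; exact hP _ _ (hΦ m)
  have hsub : ∀ m n, m ≤ n → ∀ k, ∃ j, k ≤ j ∧ Φ n k = Φ m j := by
    intro m n hmn
    induction n, hmn using Nat.le_induction with
    | base => exact fun k => ⟨k, le_rfl, rfl⟩
    | succ n _ ih =>
      intro k
      obtain ⟨j, hj, e⟩ := ih (ψ (n + 1) (Φ n) k)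
      exact ⟨j, ((hψ _ _ (hΦ n)).id_le k).trans hj, e⟩
  refine ⟨fun k => Φ k k, strictMono_nat_of_lt_succ fun k => ?_,
    fun m => ⟨Φ m, hPΦ m, fun k hk => hsub m k hk k⟩⟩
  -- `Φ (k + 1) (k + 1)` is `Φ k` evaluated at an index that is at least `k + 1`, hence beyond `k`.
  exact hΦ k ((Nat.lt_succ_self k).trans_le ((hψ _ _ (hΦ k)).id_le (k + 1)))

/-! ### Order convergence and vector norms -/

section OrderConvergence
variable {X A F : Type*} [AddCommGroup X] [Module ℝ X] [Preorder A] [AddCommGroup F]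

/-- The lower half of the two-sided estimate is automatic, because `q` and the elements of `D` are
nonnegative. -/
theorem VectorNorm.converges_iff [PartialOrder F] [IsOrderedAddMonoid F] [Module ℝ F]
    (q : VectorNorm X F) (x : A → X) (a : X) :
    q.Converges x a ↔ ∃ D : Set F, D.Nonempty ∧ DirectedOn (· ≥ ·) D ∧ IsGLB D 0 ∧
      ∀ d ∈ D, ∃ i₀ : A, ∀ i, i₀ ≤ i → q (x i - a) ≤ d := by
  constructor
  · rintro ⟨D, h1, h2, h3, h4⟩
    refine ⟨D, h1, h2, h3, fun d hd => ?_⟩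
    obtain ⟨i₀, h⟩ := h4 d hd
    exact ⟨i₀, fun i hi => by simpa using (h i hi).2⟩
  · rintro ⟨D, h1, h2, h3, h4⟩
    refine ⟨D, h1, h2, h3, fun d hd => ?_⟩
    obtain ⟨i₀, h⟩ := h4 d hd
    refine ⟨i₀, fun i hi => ⟨?_, by simpa using h i hi⟩⟩
    rw [sub_zero]
    exact (neg_nonpos.2 (h3.1 hd)).trans (q.nonneg' _)

theorem VectorNorm.map_sub_comm [PartialOrder F] [Module ℝ F] (q : VectorNorm X F) (x y : X) :
    q (x - y) = q (y - x) := by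
  have h := q.smul' (-1) (y - x)
  rwa [neg_one_smul, neg_sub, abs_neg, abs_one, one_smul] at h

theorem VectorNorm.map_sub_le [PartialOrder F] [Module ℝ F] (q : VectorNorm X F) (x y z : X) :
    q (x - z) ≤ q (x - y) + q (y - z) := by
  simpa using q.add_le' (x - y) (y - z)

/-- Directedness replaces `d + d` by `d + d'` with independent `d` and `d'`: for `c` below both, a
lower bound `l` satisfies `l ≤ c + c ≤ d + d'`. The two infima are then taken one after the other.
-/
theorem isGLB_add_self_zero [PartialOrder F] [IsOrderedAddMonoid F] {D : Set F}
    (hdir : DirectedOn (· ≥ ·) D) (hD : IsGLB D 0) : IsGLB ((fun d => d + d) '' D) 0 := by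
  constructor
  · rintro _ ⟨d, hd, rfl⟩
    exact add_nonneg (hD.1 hd) (hD.1 hd)
  · intro l hl
    refine hD.2 fun d hd => ?_
    rw [← sub_nonpos]
    refine hD.2 fun d' hd' => ?_
    obtain ⟨c, hc, h1, h2⟩ := hdir d hd d' hd'
    rw [sub_le_iff_le_add']
    exact (hl ⟨c, hc, rfl⟩).trans (add_le_add h1 h2)

/-- In an order complete space, a bounded positive sequence order converges to `0` as soon as its
eventual upper bounds have no positive lower bound. -/
theorem VectorNorm.converges_of_eventual_bounds [ConditionallyCompleteLattice F]
    [IsOrderedAddMonoid F] [Module ℝ F] (q : VectorNorm X F) (x : ℕ → X) (a : X)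
    (hb : BddAbove (Set.range fun k => q (x k - a)))
    (h : ∀ l, (∀ u, (∃ k₀, ∀ k, k₀ ≤ k → q (x k - a) ≤ u) → l ≤ u) → l ≤ 0) :
    q.Converges x a := by
  let s : ℕ → F := fun n => sSup ((fun k => q (x k - a)) '' Set.Ici n)
  have hbn : ∀ n, BddAbove ((fun k => q (x k - a)) '' Set.Ici n) :=
    fun n => hb.mono (Set.image_subset_range _ _)
  have hle : ∀ n k, n ≤ k → q (x k - a) ≤ s n := fun n k hk => le_csSup (hbn n) ⟨k, hk, rfl⟩
  have hanti : Antitone s := fun m n hmn =>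
    csSup_le_csSup (hbn m) ⟨_, n, Set.self_mem_Ici, rfl⟩ (Set.image_mono (Set.Ici_subset_Ici.2 hmn))
  refine (q.converges_iff x a).2 ⟨Set.range s, Set.range_nonempty s, ?_, ⟨?_, ?_⟩, ?_⟩
  · rintro _ ⟨m, rfl⟩ _ ⟨n, rfl⟩
    exact ⟨s (max m n), ⟨_, rfl⟩, hanti (le_max_left _ _), hanti (le_max_right _ _)⟩
  · rintro _ ⟨n, rfl⟩
    exact (q.nonneg' _).trans (hle n n le_rfl)
  · intro l hl
    -- A bound valid from `k₀` on dominates the tail supremum `s k₀`, so a lower bound of all tail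
    -- suprema lies below every eventual bound.
    refine h l fun u ⟨k₀, hu⟩ => (hl ⟨k₀, rfl⟩).trans ?_
    apply csSup_le (Set.nonempty_Ici.image _)
    rintro _ ⟨k, hk, rfl⟩
    exact hu k hk
  · rintro _ ⟨n, rfl⟩
    exact ⟨n, hle n⟩

end OrderConvergence

/-! ### Pointwise infima and uniform convergence of operators -/

/-- The infimum of a downward directed set of order bounded operators is pointwise on the positive
cone. -/
theorem OrderBoundedOp.isGLB_eval {E F : Type*}
    [AddCommGroup E] [Lattice E] [IsOrderedAddMonoid E] [Module ℝ E] [IsOrderedModule ℝ E]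
    [AddCommGroup F] [ConditionallyCompleteLattice F] [IsOrderedAddMonoid F] [Module ℝ F]
    [IsOrderedModule ℝ F] {D : Set (OrderBoundedOp E F)} (hne : D.Nonempty)
    (hdir : DirectedOn (· ≥ ·) D) (hD : IsGLB D 0) {e : E} (he : 0 ≤ e) :
    IsGLB ((fun S => S.toLin e) '' D) 0 := by
  let V : E → Set F := fun a => (fun S => S.toLin a) '' D
  let f : E → F := fun a => sInf (V a)
  have hpos : ∀ S ∈ D, ∀ a, 0 ≤ a → 0 ≤ S.toLin a := fun S hS a ha => hD.1 hS a ha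
  have hneV : ∀ a, (V a).Nonempty := fun a => hne.image _
  have hlb : ∀ a, 0 ≤ a → (0 : F) ∈ lowerBounds (V a) := by
    rintro a ha _ ⟨S, hS, rfl⟩
    exact hpos S hS a ha
  have hf : ∀ a, 0 ≤ a → IsGLB (V a) (f a) := fun a ha => isGLB_csInf (hneV a) ⟨0, hlb a ha⟩
  have hfle : ∀ a, 0 ≤ a → ∀ S ∈ D, f a ≤ S.toLin a := fun a ha S hS => (hf a ha).1 ⟨S, hS, rfl⟩
  have hfpos : ∀ a, 0 ≤ a → 0 ≤ f a := fun a ha => (hf a ha).2 (hlb a ha)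
  have hadd : ∀ a b, 0 ≤ a → 0 ≤ b → f (a + b) = f a + f b := by
    intro a b ha hb
    apply le_antisymm
    · rw [← sub_le_iff_le_add]
      refine (hf a ha).2 ?_
      rintro _ ⟨S, hS, rfl⟩
      rw [sub_le_comm]
      refine (hf b hb).2 ?_
      rintro _ ⟨R, hR, rfl⟩
      -- Directedness is what makes the pointwise infimum subadditive: one `U ∈ D` below both
      -- operators gives `f (a + b) ≤ U a + U b ≤ S a + R b`.
      obtain ⟨U, hU, h1, h2⟩ := hdir S hS R hR
      rw [sub_le_iff_le_add']
      refine (hfle _ (add_nonneg ha hb) U hU).trans ?_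
      rw [map_add]
      exact add_le_add (h1 a ha) (h2 b hb)
    · refine (hf _ (add_nonneg ha hb)).2 ?_
      rintro _ ⟨S, hS, rfl⟩
      change _ ≤ S.toLin (a + b)
      rw [map_add]
      exact add_le_add (hfle a ha S hS) (hfle b hb S hS)
  have hsle : ∀ (c : ℝ) a, 0 ≤ c → 0 ≤ a → c • f a ≤ f (c • a) := by
    intro c a hc ha
    refine (hf _ (smul_nonneg hc ha)).2 ?_
    rintro _ ⟨S, hS, rfl⟩
    change _ ≤ S.toLin (c • a)
    rw [map_smul]
    exact smul_le_smul_of_nonneg_left (hfle a ha S hS) hc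
  have f0 : f 0 = 0 := by simpa using hadd 0 0 le_rfl le_rfl
  have hsmul : ∀ (c : ℝ) a, 0 ≤ c → 0 ≤ a → f (c • a) = c • f a := by
    intro c a hc ha
    refine le_antisymm ?_ (hsle c a hc ha)
    rcases hc.eq_or_lt with rfl | hc'
    · rw [zero_smul, zero_smul, f0]
    · have h := smul_le_smul_of_nonneg_left
        (hsle c⁻¹ (c • a) (inv_nonneg.2 hc) (smul_nonneg hc ha)) hc
      rwa [inv_smul_smul₀ hc'.ne', smul_inv_smul₀ hc'.ne'] at h
  obtain ⟨R, hR⟩ := exists_linear_extension f hadd hsmul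
  have hRpos : ∀ a, 0 ≤ a → 0 ≤ R a := fun a ha => by rw [hR a ha]; exact hfpos a ha
  -- The pointwise infimum is itself an operator and a lower bound of `D`, so it cannot exceed `0`.
  have hR0 : OrderBoundedOp.ofPositive R hRpos ≤ 0 := hD.2 fun S hS a ha => by
    rw [OrderBoundedOp.toLin_ofPositive, hR a ha]
    exact hfle a ha S hS
  have h0 : f e = 0 := by
    refine le_antisymm ?_ (hfpos e he)
    have := hR0 e he
    rwa [OrderBoundedOp.toLin_ofPositive, hR e he] at this
  rw [← h0]
  exact hf e he

/-- `p`-convergence in `M(X, Y)` is uniform on `p`-bounded sets. -/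
theorem exists_uniform_bound_of_dominantNorm_converges {X Y E F : Type*}
    [AddCommGroup X] [Module ℝ X] [AddCommGroup Y] [Module ℝ Y]
    [AddCommGroup E] [Lattice E] [IsOrderedAddMonoid E] [Module ℝ E] [IsOrderedModule ℝ E]
    [AddCommGroup F] [ConditionallyCompleteLattice F] [IsOrderedAddMonoid F] [Module ℝ F]
    [IsOrderedModule ℝ F] (p : VectorNorm X E) (q : VectorNorm Y F) (hp : p.Decomposable)
    {T : ℕ → dominatedOperators p q} {T₀ : dominatedOperators p q}
    (hconv : (dominantNorm p q hp).Converges T T₀) {e : E} (he : 0 ≤ e) :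
    ∃ D : Set F, D.Nonempty ∧ DirectedOn (· ≥ ·) D ∧ IsGLB D 0 ∧
      ∀ d ∈ D, ∃ m₀, ∀ m, m₀ ≤ m → ∀ x, p x ≤ e → q ((T m).1 x - T₀.1 x) ≤ d := by
  obtain ⟨D, hne, hdir, hglb, hD⟩ := hconv
  refine ⟨_, hne.image _, ?_, OrderBoundedOp.isGLB_eval hne hdir hglb he, ?_⟩
  · rintro _ ⟨S, hS, rfl⟩ _ ⟨R, hR, rfl⟩
    obtain ⟨U, hU, h1, h2⟩ := hdir S hS R hR
    exact ⟨_, ⟨U, hU, rfl⟩, h1 e he, h2 e he⟩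
  · rintro _ ⟨S, hS, rfl⟩
    obtain ⟨m₀, hm₀⟩ := hD S hS
    refine ⟨m₀, fun m hm x hx => ?_⟩
    obtain ⟨hpos, hdom⟩ := (exactDominant_spec p q hp (T m - T₀)).1
    have hle := (hm₀ m hm).2
    rw [sub_zero] at hle
    have hmono := hpos _ (sub_nonneg.2 hx)
    rw [map_sub, sub_nonneg] at hmono
    exact (hdom x).trans (hmono.trans (hle e he))

/-! ### Compactness of the limit operator -/

theorem mainTheorem12 {X Y E F : Type*} [AddCommGroup X] [Module ℝ X]
    [AddCommGroup Y] [Module ℝ Y]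
    [AddCommGroup E] [Lattice E] [IsOrderedAddMonoid E] [Module ℝ E] [IsOrderedModule ℝ E]
    [AddCommGroup F] [ConditionallyCompleteLattice F] [IsOrderedAddMonoid F] [Module ℝ F]
    [IsOrderedModule ℝ F]
    (hE : ArchimedeanSpace E)
    (p : VectorNorm X E) (q : VectorNorm Y F)
    (hp : p.Decomposable) (hq : q.SeqComplete)
    (T : ℕ → dominatedOperators p q) (T₀ : dominatedOperators p q)
    (hT : ∀ m, SeqPCompact p q (T m : X →ₗ[ℝ] Y))
    (hconv : (dominantNorm p q hp).Converges T T₀) :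
    SeqPCompact p q (T₀ : X →ₗ[ℝ] Y) := by
  rintro x ⟨e, hxe⟩
  replace hxe : ∀ n, p (x n) ≤ e := fun n => hxe _ ⟨n, rfl⟩
  have he : 0 ≤ e := (p.nonneg' _).trans (hxe 0)
  obtain ⟨δ, hδ, hdiag⟩ := exists_strictMono_diagonal
    (P := fun m φ => ∃ y, q.Converges (fun k => (T m).1 (x (φ k))) y) fun m φ _ =>
      hT m (x ∘ φ) ⟨e, by rintro _ ⟨n, rfl⟩; exact hxe _⟩
  have hlim : ∀ m, ∃ y, ∃ C : Set F, IsGLB C 0 ∧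
      ∀ c ∈ C, ∃ k₀, ∀ k, k₀ ≤ k → q ((T m).1 (x (δ k)) - y) ≤ c := by
    intro m
    obtain ⟨φ, ⟨y, hy⟩, hj⟩ := hdiag m
    obtain ⟨C, -, -, hC, hCy⟩ := (q.converges_iff _ _).1 hy
    refine ⟨y, C, hC, fun c hc => ?_⟩
    obtain ⟨k₀, hk₀⟩ := hCy c hc
    refine ⟨max m k₀, fun k hk => ?_⟩
    obtain ⟨j, hkj, hj⟩ := hj k ((le_max_left _ _).trans hk)
    -- Since `j ≥ k`, the tail estimate along `φ` passes to the diagonal sequence.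
    rw [hj]
    exact hk₀ j ((le_max_right _ _).trans (hk.trans hkj))
  choose y C hC hCy using hlim
  obtain ⟨D, hDne, hDdir, hD, hDT⟩ := exists_uniform_bound_of_dominantNorm_converges p q hp hconv he
  have hcauchy : q.IsCauchySeq y := by
    refine (q.converges_iff _ _).2 ⟨_, hDne.image _, ?_, isGLB_add_self_zero hDdir hD, ?_⟩
    · rintro _ ⟨a, ha, rfl⟩ _ ⟨b, hb, rfl⟩
      obtain ⟨c, hc, h1, h2⟩ := hDdir a ha b hb
      exact ⟨_, ⟨c, hc, rfl⟩, add_le_add h1 h1, add_le_add h2 h2⟩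
    · rintro _ ⟨d, hd, rfl⟩
      obtain ⟨m₀, hm₀⟩ := hDT d hd
      refine ⟨(m₀, m₀), fun ⟨m, n⟩ ⟨hm, hn⟩ => ?_⟩
      change q (y m - y n - 0) ≤ d + d
      rw [sub_zero, ← sub_nonpos]
      -- The left side does not involve `k`, so for fixed `c` and `c'` a single index past both
      -- thresholds suffices; the infima over `c` and `c'` remove these errors and leave `d + d`.
      refine (hC m).2 fun c hc => ?_
      rw [← sub_nonpos]
      refine (hC n).2 fun c' hc' => ?_
      obtain ⟨k₁, h₁⟩ := hCy m c hc
      obtain ⟨k₂, h₂⟩ := hCy n c' hc'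
      have g₁ := h₁ _ (le_max_left k₁ k₂)
      have g₂ := h₂ _ (le_max_right k₁ k₂)
      have g₃ := hm₀ m hm _ (hxe (δ (max k₁ k₂)))
      have g₄ := hm₀ n hn _ (hxe (δ (max k₁ k₂)))
      rw [q.map_sub_comm] at g₁ g₄
      rw [sub_le_iff_le_add, sub_le_iff_le_add]
      calc q (y m - y n) ≤ _ := q.map_sub_le _ _ _
        _ ≤ _ := add_le_add g₁ (q.map_sub_le _ _ _)
        _ ≤ _ := add_le_add le_rfl (add_le_add g₃ (q.map_sub_le _ _ _))
        _ ≤ c + (d + (d + c')) := by gcongr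
        _ = c' + c + (d + d) := by abel
  obtain ⟨z, hz⟩ := hq y hcauchy
  obtain ⟨B, -, -, hB, hBz⟩ := (q.converges_iff _ _).1 hz
  refine ⟨δ, hδ, z, q.converges_of_eventual_bounds _ _ ?_ fun l hl => ?_⟩
  · obtain ⟨S, hSpos, hS⟩ := T₀.2
    -- Any dominant `S` of `T₀` bounds the images by `S e`; the triangle inequality through `0` adds
    -- the constant `q (0 - z)`.
    refine ⟨S e + q (0 - z), ?_⟩
    rintro _ ⟨k, rfl⟩
    have hmono := hSpos _ (sub_nonneg.2 (hxe (δ k)))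
    rw [map_sub, sub_nonneg] at hmono
    refine (q.map_sub_le _ 0 _).trans (add_le_add ?_ le_rfl)
    rw [sub_zero]
    exact (hS _).trans hmono
  -- The order of choices matters: `b` and `d` fix the operator index `max m₁ m₂`, and only then are
  -- `c` and the threshold `k₀` chosen for that operator.
  · refine hB.2 fun b hb => ?_
    rw [← sub_nonpos]
    refine hD.2 fun d hd => ?_
    obtain ⟨m₁, h₁⟩ := hBz b hb
    obtain ⟨m₂, h₂⟩ := hDT d hd
    have g₁ := h₁ _ (le_max_left m₁ m₂)
    rw [← sub_nonpos]
    refine (hC (max m₁ m₂)).2 fun c hc => ?_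
    rw [sub_le_iff_le_add, sub_le_iff_le_add]
    obtain ⟨k₀, hk₀⟩ := hCy _ c hc
    refine hl _ ⟨k₀, fun k hk => ?_⟩
    have g₂ := h₂ _ (le_max_right m₁ m₂) _ (hxe (δ k))
    rw [q.map_sub_comm] at g₂
    calc q (T₀.1 (x (δ k)) - z) ≤ _ := q.map_sub_le _ _ _
      _ ≤ _ := add_le_add g₂ (q.map_sub_le _ _ _)
      _ ≤ d + (c + b) := add_le_add le_rfl (add_le_add (hk₀ k hk) g₁)
      _ = c + d + b := by abel
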